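/- **Setting.** Let $P\subset\mathbb R^2$ be a simple rectilinear polygon (closed region bounded by a simple closed curve of $n$ axis-parallel edges, consecutive edges being perpendicular). Its *aspect ratio* $A$ is the ratio of its maximum to its minimum edge length; $P$ is *orthoconvex* if every horizontal and every vertical line meets it in an interval (possibly empty or a point). Points $p,q\in P$ *see* each other if the segment $pq$ lies in $P$. A robot starts at a point $s\in P$ and makes a closed tour inside $P$, along which it takes finitely many scans; a scan taken at $p$ reveals the set of points of $P$ seen from $p$ and which of them lie on the boundary, and nothing is seen between scans. The tour *explores* $P$ if every point of $P$ is seen from some scan point; one may demand in addition that each edge is seen entirely from a single scan point. With a fixed scan cost $c>0$, a tour costs $c\cdot(\text{number of scans})+(L_1\text{-length})$, and $\mathrm{opt}(P,s)$ is the infimum of the costs of all tours from $s$ that explore $P$. A *deterministic online strategy* determines the next move (a curve along which to travel, followed by a scan or by stopping) from $s$ and the outcomes of the scans taken so far. It is *$\rho$-competitive* on a class of polygons if, for every $P$ in the class and every $s\in P$, it stops after finitely many scans, its tour is a closed tour from $s$ inside $P$ that explores $P$, and the cost is at most $\rho\cdot\mathrm{opt}(P,s)$. **Theorem.** There is a constant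 $\kappa>0$ such that, for every scan cost $c>0$ and both with and without the additional demand on the edges, the following hold. 1. For every real $A\ge 1$: if a deterministic online strategy is $\rho$-competitive on the class of orthoconvex polygons of aspect ratio $A$, then $\rho\ge\kappa\log A$. Thus no deterministic strategy has a competitive ratio better than $\Omega(\log A)$, even if the polygon is known in advance to be orthoconvex and $A$ is known. 2. For every even $n\ge 4$: if a deterministic online strategy is $\rho$-competitive on the class of orthoconvex polygons with $n$ edges (and arbitrary coordinates), then $\rho\ge\kappa n$. Thus, in terms of the number of edges alone, there is an $\Omega(n)$ lower bound. -/

import Mathlib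

open scoped NNReal ENNReal

namespace Watchman

/-- Points of the plane, as pairs `(x, y)`. -/
abbrev Plane : Type := ℝ × ℝ

/-! ### Simple rectilinear polygons -/

/-- The cyclic successor on `Fin n`. -/
def next {n : ℕ} (i : Fin n) : Fin n :=
  ⟨(i.val + 1) % n, Nat.mod_lt _ i.pos⟩

/-- `pq` is a nondegenerate horizontal segment. -/
def IsHorizontal (p q : Plane) : Prop := p.2 = q.2 ∧ p.1 ≠ q.1

/-- `pq` is a nondegenerate vertical segment. -/
def IsVertical (p q : Plane) : Prop := p.1 = q.1 ∧ p.2 ≠ q.2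

/-- A simple rectilinear polygon: a simple closed curve with `n` axis-parallel edges, consecutive
edges being perpendicular, together with the closed region that the curve encloses. The region is
the compact, regularly closed set whose frontier is the curve; by the Jordan curve theorem it is
the curve together with its inside, and there is no other such set. -/
structure RectilinearPolygon where
  n : ℕ
  four_le : 4 ≤ n
  vertex : Fin n → Plane
  alternating : ∀ i,
    (IsHorizontal (vertex i) (vertex (next i)) ∧
      IsVertical (vertex (next i)) (vertex (next (next i)))) ∨
    (IsVertical (vertex i) (vertex (next i)) ∧
      IsHorizontal (vertex (next i)) (vertex (next (next i))))
  simple : ∀ i j, i ≠ j → j ≠ next i → i ≠ next j →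
    Disjoint (segment ℝ (vertex i) (vertex (next i))) (segment ℝ (vertex j) (vertex (next j)))
  region : Set Plane
  isCompact_region : IsCompact region
  closure_interior_region : closure (interior region) = region
  frontier_region : frontier region = ⋃ i, segment ℝ (vertex i) (vertex (next i))

namespace RectilinearPolygon

variable (P : RectilinearPolygon)

/-- The `i`-th edge. -/
def edge (i : Fin P.n) : Set Plane := segment ℝ (P.vertex i) (P.vertex (next i))

/-- The length of the `i`-th edge. -/
def edgeLength (i : Fin P.n) : ℝ :=
  |(P.vertex i).1 - (P.vertex (next i)).1| + |(P.vertex i).2 - (P.vertex (next i)).2|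

/-- The ratio of the maximum and the minimum edge length. -/
noncomputable def aspectRatio : ℝ := (⨆ i, P.edgeLength i) / (⨅ i, P.edgeLength i)

/-- Every horizontal and every vertical line meets the polygon in an interval
(possibly empty or a point). -/
def Orthoconvex : Prop :=
  (∀ y : ℝ, {x : ℝ | (x, y) ∈ P.region}.OrdConnected) ∧
  (∀ x : ℝ, {y : ℝ | (x, y) ∈ P.region}.OrdConnected)

/-- The part of the polygon that is visible from `p`. -/
def visible (p : Plane) : Set Plane := {q | segment ℝ p q ⊆ P.region}

end RectilinearPolygon

/-! ### Tours with scans -/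

/-- A parametrized continuous curve in the plane. -/
abbrev Curve : Type := C(unitInterval, Plane)

/-- The length of a curve in the `L₁` metric. -/
noncomputable def Curve.length (γ : Curve) : ℝ≥0∞ :=
  eVariationOn (fun t => WithLp.toLp 1 (γ t)) Set.univ

/-- The curves of the list, traversed one after the other, lead from `p` to `q`. -/
def Joins : Plane → List Curve → Plane → Prop
  | p, [], q => p = q
  | p, γ :: l, q => γ 0 = p ∧ Joins (γ 1) l q

/-- A tour with discrete vision: a scan is taken exactly at the end of each of the `legs`;
afterwards the robot moves along `home` without scanning. -/
structure Tour where
  legs : List Curve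
  home : Curve

/-- The scan points, in order. -/
def Tour.scanPoints (T : Tour) : List Plane := T.legs.map (fun γ => γ 1)

/-- The cost `c * (number of scans) + (tour length)`. -/
noncomputable def Tour.cost (c : ℝ≥0) (T : Tour) : ℝ≥0∞ :=
  c * T.legs.length + ((T.legs.map Curve.length).sum + Curve.length T.home)

/-- What has to be seen: every point of the polygon (`points`), possibly with the additional demand
that each edge is fully visible from a single scan point (`pointsAndEdges`). -/
inductive Rule
  | points
  | pointsAndEdges

/-- `T` is a closed tour from `s`, it stays in `P`, and its scans explore `P`. -/
structure Tour.Explores (T : Tour) (r : Rule) (P : RectilinearPolygon) (s : Plane) : Prop where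
  joins : Joins s (T.legs ++ [T.home]) s
  stays : ∀ γ ∈ T.legs ++ [T.home], ∀ t, γ t ∈ P.region
  sees : ∀ q ∈ P.region, ∃ p ∈ T.scanPoints, q ∈ P.visible p
  sees_edges : r = Rule.pointsAndEdges → ∀ i, ∃ p ∈ T.scanPoints, P.edge i ⊆ P.visible p

/-- The offline optimum: the least cost of a tour that explores `P` from `s`. -/
noncomputable def opt (r : Rule) (c : ℝ≥0) (P : RectilinearPolygon) (s : Plane) : ℝ≥0∞ :=
  ⨅ (T : Tour) (_ : T.Explores r P s), T.cost c

/-! ### Online strategies -/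

/-- The outcome of a scan: its position, the visible part of the polygon, and the visible part of
the boundary. -/
structure Observation where
  position : Plane
  visible : Set Plane
  visibleBoundary : Set Plane

/-- The scan of `P` taken from `p`. -/
def scan (P : RectilinearPolygon) (p : Plane) : Observation where
  position := p
  visible := P.visible p
  visibleBoundary := P.visible p ∩ frontier P.region

/-- The next action of the robot: move along a curve and scan at its end,
or move along a curve and stop. -/
inductive Action
  | moveAndScan (γ : Curve)
  | finish (γ : Curve)

/-- A deterministic online strategy: the next action is a function of the starting point and of the
outcomes of all scans taken so far. -/
abbrev Strategy : Type := Plane → List Observation → Action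

/-- `T` is the tour that the strategy `σ` makes in `P` from `s`. -/
def Strategy.Produces (σ : Strategy) (P : RectilinearPolygon) (s : Plane) (T : Tour) : Prop :=
  (∀ (i : ℕ) (hi : i < T.legs.length),
    σ s ((T.scanPoints.take i).map (scan P)) = Action.moveAndScan T.legs[i]) ∧
  σ s (T.scanPoints.map (scan P)) = Action.finish T.home

/-- `σ` has competitive ratio (at most) `ρ` on a class of polygons: for every polygon of the class
and every starting point in it, `σ` stops after finitely many scans, has explored the polygon, and
its cost is at most `ρ` times the offline optimum. -/
def Strategy.IsCompetitive (σ : Strategy) (r : Rule) (c : ℝ≥0) (Cl : Set RectilinearPolygon)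
    (ρ : ℝ≥0) : Prop :=
  ∀ P ∈ Cl, ∀ s ∈ P.region, ∃ T : Tour,
    σ.Produces P s T ∧ T.Explores r P s ∧ T.cost c ≤ ρ * opt r c P s

end Watchman

/-!
An adversary plays with pyramids, stacks of boxes over nested intervals `I₀ ⊇ I₁ ⊇ ⋯`. Inside each
interval the next one lies near the left or near the right end, and one bit `b i` for each `i` says
which. The part of the pyramid below a certain height depends only on the first `m` bits, and the
part above it lies over `I_m`. The boxes grow so fast in height, by a factor of `3 > 2`, that the
midpoint of a line of sight from the ground into the upper part already lies over `I_m`. Hence a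
scan sees into the upper part only if its abscissa is within the width of `I_m` from `I_m`. As the
intervals shrink by a factor of `9`, no point is that close to both candidates for `I_m`, so
the adversary can choose each bit after the scan point that it has to defeat is known. A pyramid of
`K` boxes thus costs every strategy about `K / 2` scans for some choice of the bits. But offline one
scan suffices, from the point on the ground below the apex, and when the pyramid is narrow enough
for the way there and back to cost no more than one scan, the optimum is at most `2 * c`.

The interval shrinks by `9` while the height grows by `3` twice, so a pyramid of `K` boxes whose
edges are nowhere shorter than its lowest box is high and nowhere longer than its bottom edge exists
as soon as the aspect ratio is about `3 ^ K`: this gives the bound in terms of `A`. There are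
`2 * K + 2` edges, which gives the bound in terms of `n`.
-/

namespace Watchman

/-! ### Tours with a single scan -/

theorem length_pathSegment_le (p q : Plane) :
    Curve.length (Path.segment p q) ≤ edist (WithLp.toLp 1 p) (WithLp.toLp 1 q) := by
  have hval : eVariationOn ((↑) : unitInterval → ℝ) Set.univ = 1 := by
    have hmono := (Subtype.mono_coe (· ∈ unitInterval)).monotoneOn Set.univ
    have hIcc : Set.Icc (0 : unitInterval) 1 = Set.univ :=
      Set.eq_univ_of_forall fun _ => ⟨unitInterval.nonneg', unitInterval.le_one'⟩
    simpa [hIcc] using hmono.eVariationOn_eq (Set.mem_univ 0) (Set.mem_univ 1)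
  have hwalk : (fun t => WithLp.toLp 1 (Path.segment p q t)) =
      AffineMap.lineMap (k := ℝ) (WithLp.toLp 1 p) (WithLp.toLp 1 q) ∘ Subtype.val := by
    ext t
    simp [AffineMap.lineMap_apply]
  calc Curve.length (Path.segment p q)
      = eVariationOn (AffineMap.lineMap (k := ℝ) (WithLp.toLp 1 p) (WithLp.toLp 1 q) ∘
          ((↑) : unitInterval → ℝ)) Set.univ :=
        congrArg (eVariationOn · Set.univ) hwalk
    _ ≤ nndist (WithLp.toLp 1 p) (WithLp.toLp 1 q) *
          eVariationOn ((↑) : unitInterval → ℝ) Set.univ :=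
        ((lipschitzWith_lineMap _ _).lipschitzOnWith (s := Set.univ)).comp_eVariationOn_le
          (Set.mapsTo_univ _ _)
    _ = edist (WithLp.toLp 1 p) (WithLp.toLp 1 q) := by rw [hval, mul_one, edist_nndist]

theorem RectilinearPolygon.edge_subset_region (P : RectilinearPolygon) (i : Fin P.n) :
    P.edge i ⊆ P.region :=
  calc P.edge i ⊆ frontier P.region :=
        (Set.subset_iUnion P.edge i).trans_eq P.frontier_region.symm
    _ ⊆ P.region := P.isCompact_region.isClosed.frontier_subset

/-- The tour that walks straight from `s` to `p`, scans there and returns. -/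
noncomputable def singleScanTour (s p : Plane) : Tour where
  legs := [(Path.segment s p : Curve)]
  home := Path.segment p s

theorem singleScanTour_explores {P : RectilinearPolygon} {s p : Plane}
    (hs : s ∈ P.region) (hp : P.visible p = P.region) (r : Rule) :
    (singleScanTour s p).Explores r P s := by
  have hscan : p ∈ (singleScanTour s p).scanPoints := by simp [singleScanTour, Tour.scanPoints]
  have hps : segment ℝ p s ⊆ P.region := hp.ge hs
  refine ⟨by simp [singleScanTour, Joins], ?_, fun q hq => ⟨p, hscan, hp.ge hq⟩,
    fun _ i => ⟨p, hscan, hp.symm ▸ P.edge_subset_region i⟩⟩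
  intro γ hγ t
  obtain rfl | rfl : γ = (Path.segment s p : Curve) ∨ γ = (Path.segment p s : Curve) := by
    simpa [singleScanTour] using hγ
  · exact hps (segment_symm ℝ s p ▸ Path.range_segment s p ▸ Set.mem_range_self t)
  · exact hps (Path.range_segment p s ▸ Set.mem_range_self t)

theorem opt_le_of_visible_eq_region {P : RectilinearPolygon} {s p : Plane}
    (hs : s ∈ P.region) (hp : P.visible p = P.region) (r : Rule) (c : ℝ≥0) :
    opt r c P s ≤ c + 2 * edist (WithLp.toLp 1 s) (WithLp.toLp 1 p) :=
  calc opt r c P s ≤ (singleScanTour s p).cost c :=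
        iInf₂_le (singleScanTour s p) (singleScanTour_explores hs hp r)
    _ = c + (Curve.length (Path.segment s p) + Curve.length (Path.segment p s)) := by
        simp [Tour.cost, singleScanTour]
    _ ≤ c + (edist (WithLp.toLp 1 s) (WithLp.toLp 1 p) +
          edist (WithLp.toLp 1 p) (WithLp.toLp 1 s)) := by
        gcongr <;> exact length_pathSegment_le _ _
    _ = c + 2 * edist (WithLp.toLp 1 s) (WithLp.toLp 1 p) := by
        rw [edist_comm (WithLp.toLp 1 p), two_mul]

/-! ### Indistinguishable scans -/

theorem RectilinearPolygon.visible_subset_visible_of_inter_subset {P Q : RectilinearPolygon}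
    {U : Set Plane} {p : Plane} (hPQ : P.region ∩ U ⊆ Q.region) (hP : P.visible p ⊆ U) :
    P.visible p ⊆ Q.visible p := by
  intro q hq z hz
  have hz_visible : z ∈ P.visible p :=
    ((convex_segment p q).segment_subset (left_mem_segment ℝ p q) hz).trans hq
  exact hPQ ⟨hq hz, hP hz_visible⟩

theorem scan_eq_of_region_inter_eq {P Q : RectilinearPolygon} {U : Set Plane} (hU : IsOpen U)
    (hPQ : P.region ∩ U = Q.region ∩ U) {p : Plane} (hP : P.visible p ⊆ U)
    (hQ : Q.visible p ⊆ U) : scan P p = scan Q p := by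
  have hvisible : P.visible p = Q.visible p :=
    (RectilinearPolygon.visible_subset_visible_of_inter_subset
      (hPQ.trans_subset Set.inter_subset_left) hP).antisymm
    (RectilinearPolygon.visible_subset_visible_of_inter_subset
      (hPQ.symm.trans_subset Set.inter_subset_left) hQ)
  have hfrontier : frontier P.region ∩ U = frontier Q.region ∩ U := by
    rw [← frontier_inter_open_inter hU, hPQ, frontier_inter_open_inter hU]
  have hboundary : P.visible p ∩ frontier P.region = Q.visible p ∩ frontier Q.region :=
    calc P.visible p ∩ frontier P.region
        = P.visible p ∩ (frontier P.region ∩ U) := by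
          rw [Set.inter_comm _ U, ← Set.inter_assoc, Set.inter_eq_left.2 hP]
      _ = Q.visible p ∩ (frontier Q.region ∩ U) := by rw [hvisible, hfrontier]
      _ = Q.visible p ∩ frontier Q.region := by
          rw [Set.inter_comm _ U, ← Set.inter_assoc, Set.inter_eq_left.2 hQ]
  unfold scan
  rw [hboundary, hvisible]

/-! ### The adversary -/

/-- The outcomes, in order, of the scans that the tour takes in `P`. -/
def Tour.observations (T : Tour) (P : RectilinearPolygon) : List Observation :=
  T.scanPoints.map (scan P)

theorem Tour.length_observations (T : Tour) (P : RectilinearPolygon) :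
    (T.observations P).length = T.legs.length := by
  simp [Tour.observations, Tour.scanPoints]

theorem Tour.take_succ_observations (T : Tour) (P : RectilinearPolygon) {j : ℕ}
    (hj : j < T.legs.length) :
    (T.observations P).take (j + 1) = (T.observations P).take j ++ [scan P (T.legs[j] 1)] := by
  rw [List.take_succ_eq_append_getElem (by rwa [T.length_observations])]
  simp [Tour.observations, Tour.scanPoints]

theorem Tour.Explores.lt_length_legs {T : Tour} {r : Rule} {P : RectilinearPolygon} {s q : Plane}
    (hT : T.Explores r P s) (hq : q ∈ P.region) {j : ℕ}
    (hunseen : ∀ o ∈ (T.observations P).take j, q ∉ o.visible) : j < T.legs.length := by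
  by_contra! hle
  obtain ⟨p, hp, hqp⟩ := hT.sees q hq
  rw [List.take_of_length_le (T.length_observations P ▸ hle)] at hunseen
  exact hunseen _ (List.mem_map_of_mem hp) hqp

theorem Strategy.Produces.eq_moveAndScan {σ : Strategy} {P : RectilinearPolygon} {s : Plane}
    {T : Tour} (hT : σ.Produces P s T) {j : ℕ} (hj : j < T.legs.length) :
    σ s ((T.observations P).take j) = Action.moveAndScan T.legs[j] := by
  rw [Tour.observations, ← List.map_take]
  exact hT.1 j hj

/-- A family of polygons, indexed by sequences, that evades `N` scans: for `m < N`, whatever the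
first `m` entries and the next scan point `p` are, the adversary can fix one further entry such that
the outcome `o` of the scan at `p` does not depend on the remaining entries and does not contain the
marked point `apex b` of any of the polygons that are still possible. -/
def Evasive {α : Type*} (P : (ℕ → α) → RectilinearPolygon) (apex : (ℕ → α) → Plane) (N : ℕ) :
    Prop :=
  ∀ m < N, ∀ (b : ℕ → α) (p : Plane), ∃ (a : α) (o : Observation),
    ∀ b' ∈ PiNat.cylinder (Function.update b m a) (m + 1),
      scan (P b') p = o ∧ apex b' ∉ o.visible

namespace Evasive

variable {α : Type*} {P : (ℕ → α) → RectilinearPolygon} {apex : (ℕ → α) → Plane} {N : ℕ}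
  {σ : Strategy} {r : Rule} {s : Plane}

theorem exists_observations [Nonempty α] (hP : Evasive P apex N)
    (hapex : ∀ b, apex b ∈ (P b).region) {T : (ℕ → α) → Tour}
    (hproduces : ∀ b, σ.Produces (P b) s (T b)) (hexplores : ∀ b, (T b).Explores r (P b) s)
    {j : ℕ} (hj : j ≤ N) :
    ∃ (b : ℕ → α) (l : List Observation), ∀ b' ∈ PiNat.cylinder b j,
      ((T b').observations (P b')).take j = l ∧ ∀ o ∈ l, apex b' ∉ o.visible := by
  induction j with
  | zero => exact ⟨fun _ => Classical.arbitrary α, [], by simp⟩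
  | succ j ih =>
    obtain ⟨b, l, hl⟩ := ih (Nat.le_of_succ_le hj)
    have hlt (b') (hb' : b' ∈ PiNat.cylinder b j) : j < (T b').legs.length :=
      (hexplores b').lt_length_legs (hapex b') ((hl b' hb').1 ▸ (hl b' hb').2)
    have hmove (b') (hb' : b' ∈ PiNat.cylinder b j) :
        σ s l = Action.moveAndScan ((T b').legs[j]'(hlt b' hb')) := by
      rw [← (hl b' hb').1, (hproduces b').eq_moveAndScan]
    obtain ⟨γ, hγ⟩ : ∃ γ, σ s l = Action.moveAndScan γ := ⟨_, hmove b (PiNat.self_mem_cylinder b j)⟩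
    obtain ⟨a, o, ho⟩ := hP j hj b (γ 1)
    refine ⟨Function.update b j a, l ++ [o], fun b' hb' => ?_⟩
    have hb'_j : b' ∈ PiNat.cylinder b j := by
      rw [← PiNat.mem_cylinder_iff_eq.1 (PiNat.update_mem_cylinder b j a)]
      exact PiNat.cylinder_anti _ j.le_succ hb'
    have hleg : (T b').legs[j]'(hlt b' hb'_j) = γ :=
      Action.moveAndScan.inj ((hmove b' hb'_j).symm.trans hγ)
    obtain ⟨hscan, hunseen⟩ := ho b' hb'
    refine ⟨?_, ?_⟩
    · rw [Tour.take_succ_observations _ _ (hlt b' hb'_j), (hl b' hb'_j).1, hleg, hscan]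
    · simpa [or_imp, forall_and] using ⟨(hl b' hb'_j).2, hunseen⟩

theorem succ_le_mul_of_isCompetitive [Nonempty α] (hP : Evasive P apex N)
    (hapex : ∀ b, apex b ∈ (P b).region) {c : ℝ≥0} (hc : 0 < c) {k : ℝ≥0}
    (hs : ∀ b, s ∈ (P b).region) (hopt : ∀ b, opt r c (P b) s ≤ k * c)
    {Cl : Set RectilinearPolygon} (hCl : ∀ b, P b ∈ Cl) {ρ : ℝ≥0}
    (hσ : σ.IsCompetitive r c Cl ρ) : (N + 1 : ℝ≥0) ≤ ρ * k := by
  choose T hproduces hexplores hcost using fun b => hσ (P b) (hCl b) s (hs b)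
  obtain ⟨b, l, hl⟩ := hP.exists_observations hapex hproduces hexplores le_rfl
  obtain ⟨hobs, hunseen⟩ := hl b (PiNat.self_mem_cylinder b N)
  have hscans : N < (T b).legs.length :=
    (hexplores b).lt_length_legs (hapex b) (hobs ▸ hunseen)
  have hcost' : (c : ℝ≥0∞) * (N + 1) ≤ ρ * (k * c) :=
    calc (c : ℝ≥0∞) * (N + 1) ≤ c * (T b).legs.length := by gcongr; exact_mod_cast hscans
      _ ≤ (T b).cost c := le_self_add
      _ ≤ ρ * opt r c (P b) s := hcost b
      _ ≤ ρ * (k * c) := by gcongr; exact hopt b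
  have hcost'' : c * (N + 1) ≤ c * (ρ * k) := by
    rw [mul_left_comm, mul_comm c k]
    exact_mod_cast hcost'
  exact le_of_mul_le_mul_left hcost'' hc

end Evasive

/-! ### Histograms -/

theorem val_next_of_lt {n : ℕ} {i : Fin n} (hi : i.val + 1 < n) : (next i).val = i.val + 1 :=
  Nat.mod_eq_of_lt hi

theorem val_next_of_eq {n : ℕ} {i : Fin n} (hi : i.val + 1 = n) : (next i).val = 0 := by
  rw [next, Fin.val_mk, hi, Nat.mod_self]

theorem segment_eq_uIcc_prod_uIcc {p q : Plane} (h : p.1 = q.1 ∨ p.2 = q.2) :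
    segment ℝ p q = Set.uIcc p.1 q.1 ×ˢ Set.uIcc p.2 q.2 := by
  obtain ⟨p₁, p₂⟩ := p
  obtain ⟨q₁, q₂⟩ := q
  obtain rfl | rfl : p₁ = q₁ ∨ p₂ = q₂ := h
  · rw [← Prod.image_mk_segment_right, segment_eq_uIcc, Set.uIcc_self, Set.singleton_prod]
  · rw [← Prod.image_mk_segment_left, segment_eq_uIcc, Set.uIcc_self, Set.prod_singleton]

theorem RectilinearPolygon.aspectRatio_eq {P : RectilinearPolygon} {a b : ℝ}
    (ha : IsLeast (Set.range P.edgeLength) a) (hb : IsGreatest (Set.range P.edgeLength) b) :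
    P.aspectRatio = b / a := by
  rw [aspectRatio, iSup, iInf, hb.csSup_eq, ha.csInf_eq]

theorem exists_mem_Icc_succ {α : Type*} [LinearOrder α] {f : ℕ → α} {x : α} {m k : ℕ}
    (hmk : m < k) (hx : x ∈ Set.Icc (f m) (f k)) :
    ∃ j, m ≤ j ∧ j < k ∧ x ∈ Set.Icc (f j) (f (j + 1)) := by
  induction k, hmk using Nat.le_induction with
  | base => exact ⟨m, le_rfl, m.lt_succ_self, hx⟩
  | succ k hk ih =>
    rcases le_total x (f k) with hxk | hxk
    · obtain ⟨j, hmj, hjk, hj⟩ := ih ⟨hx.1, hxk⟩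
      exact ⟨j, hmj, hjk.trans k.lt_succ_self, hj⟩
    · exact ⟨k, Nat.le_of_succ_le hk, k.lt_succ_self, hxk, hx.2⟩

/-- A sequence of bars that stand side by side on the `x`-axis, the `j`-th one on the interval from
`grid j` to `grid (j + 1)` and of height `height (j + 1)`. The shift makes room for the height `0`
on either side, so that the vertical edge on the line `x = grid j` always joins the heights
`height j` and `height (j + 1)`. -/
structure Histogram where
  numBars : ℕ
  numBars_pos : 0 < numBars
  grid : ℕ → ℝ
  height : ℕ → ℝ
  strictMonoOn_grid : StrictMonoOn grid (Set.Iic numBars)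
  height_zero : height 0 = 0
  height_last : height (numBars + 1) = 0
  height_pos : ∀ j < numBars, 0 < height (j + 1)
  height_ne : ∀ j ≤ numBars, height j ≠ height (j + 1)

namespace Histogram

variable (H : Histogram)

/-- The `j`-th bar. -/
def bar (j : ℕ) : Set Plane :=
  Set.Icc (H.grid j) (H.grid (j + 1)) ×ˢ Set.Icc 0 (H.height (j + 1))

/-- The region covered by the bars. -/
def region : Set Plane := ⋃ j ∈ Set.Iio H.numBars, H.bar j

variable {H}

theorem mem_region {q : Plane} : q ∈ H.region ↔ ∃ j < H.numBars, q ∈ H.bar j := by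
  simp [region]

theorem grid_le_grid_iff {i j : ℕ} (hi : i ≤ H.numBars) (hj : j ≤ H.numBars) :
    H.grid i ≤ H.grid j ↔ i ≤ j :=
  H.strictMonoOn_grid.le_iff_le hi hj

theorem grid_lt_grid_iff {i j : ℕ} (hi : i ≤ H.numBars) (hj : j ≤ H.numBars) :
    H.grid i < H.grid j ↔ i < j :=
  H.strictMonoOn_grid.lt_iff_lt hi hj

theorem isCompact_region : IsCompact H.region :=
  (Set.finite_Iio H.numBars).isCompact_biUnion fun _ _ => isCompact_Icc.prod isCompact_Icc

theorem region_subset :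
    H.region ⊆ Set.Icc (H.grid 0) (H.grid H.numBars) ×ˢ Set.Ici 0 := by
  refine Set.iUnion₂_subset fun j (hj : j < H.numBars) => Set.prod_mono ?_ Set.Icc_subset_Ici_self
  exact Set.Icc_subset_Icc ((grid_le_grid_iff (Nat.zero_le _) hj.le).2 j.zero_le)
    ((grid_le_grid_iff hj le_rfl).2 hj)

theorem disjoint_region {j : ℕ} (hj : j < H.numBars) :
    Disjoint H.region
      (Set.Ioo (H.grid j) (H.grid (j + 1)) ×ˢ Set.Ioi (H.height (j + 1))) := by
  refine Set.disjoint_left.2 fun q hq ⟨⟨hjq, hqj⟩, hheight⟩ => ?_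
  obtain ⟨i, hi, ⟨hiq, hqi⟩, -, hqheight⟩ := mem_region.1 hq
  have hij : i < j + 1 := (grid_lt_grid_iff hi.le hj).1 (hiq.trans_lt hqj)
  have hji : j < i + 1 := (grid_lt_grid_iff hj.le hi).1 (hjq.trans_le hqi)
  obtain rfl : i = j := by omega
  exact hheight.not_ge hqheight

theorem closure_interior_region : closure (interior H.region) = H.region := by
  refine (closure_minimal interior_subset isCompact_region.isClosed).antisymm ?_
  refine Set.iUnion₂_subset fun j (hj : j < H.numBars) => ?_
  have hgrid : H.grid j < H.grid (j + 1) := (grid_lt_grid_iff hj.le hj).2 j.lt_succ_self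
  calc H.bar j = closure (interior (H.bar j)) := by
        rw [bar, interior_prod_eq, closure_prod_eq, interior_Icc, interior_Icc,
          closure_Ioo hgrid.ne, closure_Ioo (H.height_pos j hj).ne]
    _ ⊆ closure (interior H.region) :=
        closure_mono (interior_mono (Set.subset_biUnion_of_mem (u := H.bar) hj))

theorem mem_interior_region {q : Plane} :
    q ∈ interior H.region ↔ q.1 ∈ Set.Ioo (H.grid 0) (H.grid H.numBars) ∧ 0 < q.2 ∧
      ∀ j < H.numBars, q.1 ∈ Set.Icc (H.grid j) (H.grid (j + 1)) → q.2 < H.height (j + 1) := by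
  constructor
  · intro hq
    have hq' := interior_mono region_subset hq
    rw [interior_prod_eq, interior_Icc, interior_Ici] at hq'
    refine ⟨hq'.1, hq'.2, fun j hj hqj => ?_⟩
    by_contra! hheight
    have hdisjoint :=
      ((disjoint_region hj).mono_left interior_subset).closure_right isOpen_interior
    have hgrid : H.grid j < H.grid (j + 1) := (grid_lt_grid_iff hj.le hj).2 j.lt_succ_self
    rw [closure_prod_eq, closure_Ioo hgrid.ne, closure_Ioi] at hdisjoint
    exact hdisjoint.notMem_of_mem_left hq ⟨hqj, hheight⟩
  · rintro ⟨hx, hy, hbelow⟩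
    let above := ⋃ j ∈ Set.Iio H.numBars,
      Set.Icc (H.grid j) (H.grid (j + 1)) ×ˢ Set.Ici (H.height (j + 1))
    have hclosed : IsClosed above :=
      (Set.finite_Iio H.numBars).isClosed_biUnion fun _ _ => isClosed_Icc.prod isClosed_Ici
    refine interior_maximal (s := H.region) ?_
      ((isOpen_Ioo.prod isOpen_Ioi).sdiff hclosed) ⟨⟨hx, hy⟩, ?_⟩
    · rintro z ⟨⟨hz₁, hz₂⟩, hz⟩
      obtain ⟨j, -, hj, hzj⟩ := exists_mem_Icc_succ H.numBars_pos (Set.Ioo_subset_Icc_self hz₁)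
      refine mem_region.2 ⟨j, hj, hzj, le_of_lt hz₂, ?_⟩
      by_contra! hheight
      exact hz (Set.mem_biUnion hj ⟨hzj, hheight.le⟩)
    · simp only [above, Set.mem_iUnion, not_exists]
      exact fun j hj hqj => (hbelow j hj hqj.1).not_ge hqj.2

variable (H)

/-- The vertices, in clockwise order from the bottom left one. -/
def vertex (i : ℕ) : Plane := (H.grid (i / 2), H.height ((i + 1) / 2))

/-- The edge that joins `vertex i` and `vertex (i + 1)`: on the line `x = grid j` for `i = 2 * j`,
and the top of the `j`-th bar for `i = 2 * j + 1`. -/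
def side (i : ℕ) : Set Plane :=
  Set.Icc (H.grid (i / 2)) (H.grid ((i + 1) / 2)) ×ˢ
    Set.uIcc (H.height ((i + 1) / 2)) (H.height (i / 2 + 1))

/-- The edge that joins the last vertex and the first one. -/
def base : Set Plane := Set.Icc (H.grid 0) (H.grid H.numBars) ×ˢ {0}

variable {H}

theorem vertex_zero : H.vertex 0 = (H.grid 0, 0) := by simp [vertex, H.height_zero]

theorem vertex_last : H.vertex (2 * H.numBars + 1) = (H.grid H.numBars, 0) := by
  rw [vertex, show (2 * H.numBars + 1) / 2 = H.numBars by omega,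
    show (2 * H.numBars + 1 + 1) / 2 = H.numBars + 1 by omega, H.height_last]

theorem side_two_mul (j : ℕ) :
    H.side (2 * j) = {H.grid j} ×ˢ Set.uIcc (H.height j) (H.height (j + 1)) := by
  rw [side, show 2 * j / 2 = j by omega, show (2 * j + 1) / 2 = j by omega, Set.Icc_self]

theorem side_two_mul_add_one (j : ℕ) :
    H.side (2 * j + 1) = Set.Icc (H.grid j) (H.grid (j + 1)) ×ˢ {H.height (j + 1)} := by
  rw [side, show (2 * j + 1) / 2 = j by omega, show (2 * j + 1 + 1) / 2 = j + 1 by omega,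
    Set.uIcc_self]

theorem isVertical_vertex {i : ℕ} (hi : i ≤ 2 * H.numBars) (heven : Even i) :
    IsVertical (H.vertex i) (H.vertex (i + 1)) := by
  obtain ⟨j, rfl⟩ := heven.two_dvd
  refine ⟨congrArg H.grid (by omega), ?_⟩
  simp only [vertex, show (2 * j + 1) / 2 = j by omega, show (2 * j + 1 + 1) / 2 = j + 1 by omega]
  exact H.height_ne j (by omega)

theorem isHorizontal_vertex {i : ℕ} (hi : i < 2 * H.numBars) (hodd : Odd i) :
    IsHorizontal (H.vertex i) (H.vertex (i + 1)) := by
  obtain ⟨j, rfl⟩ := hodd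
  refine ⟨congrArg H.height (by omega), ?_⟩
  simp only [vertex, show (2 * j + 1) / 2 = j by omega, show (2 * j + 1 + 1) / 2 = j + 1 by omega]
  exact ((grid_lt_grid_iff (by omega) (by omega)).2 j.lt_succ_self).ne

theorem isHorizontal_vertex_last : IsHorizontal (H.vertex (2 * H.numBars + 1)) (H.vertex 0) := by
  rw [vertex_last, vertex_zero]
  exact ⟨rfl, ((grid_lt_grid_iff (Nat.zero_le _) le_rfl).2 H.numBars_pos).ne'⟩

theorem segment_vertex {i : ℕ} (hi : i ≤ 2 * H.numBars) :
    segment ℝ (H.vertex i) (H.vertex (i + 1)) = H.side i := by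
  have hparallel : (H.vertex i).1 = (H.vertex (i + 1)).1 ∨
      (H.vertex i).2 = (H.vertex (i + 1)).2 := by
    rcases Nat.even_or_odd i with heven | hodd
    · exact Or.inl (isVertical_vertex hi heven).1
    · exact Or.inr (isHorizontal_vertex (hi.lt_of_ne (by grind)) hodd).1
  have hgrid : H.grid (i / 2) ≤ H.grid ((i + 1) / 2) :=
    (grid_le_grid_iff (by omega) (by omega)).2 (by omega)
  rw [segment_eq_uIcc_prod_uIcc hparallel, side, ← Set.uIcc_of_le hgrid,
    show i / 2 + 1 = (i + 1 + 1) / 2 by omega]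
  rfl

theorem segment_vertex_last :
    segment ℝ (H.vertex (2 * H.numBars + 1)) (H.vertex 0) = H.base := by
  have hgrid := (grid_le_grid_iff (H := H) (Nat.zero_le _) le_rfl).2 (Nat.zero_le H.numBars)
  rw [segment_eq_uIcc_prod_uIcc (Or.inr isHorizontal_vertex_last.1), vertex_last, vertex_zero,
    Set.uIcc_self, Set.uIcc_of_ge hgrid, base]

theorem disjoint_side_side {i j : ℕ} (hij : i + 2 ≤ j) (hj : j ≤ 2 * H.numBars) :
    Disjoint (H.side i) (H.side j) := by
  rw [side, side, Set.disjoint_prod]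
  by_cases hlt : (i + 1) / 2 < j / 2
  · refine Or.inl (Set.disjoint_left.2 fun x hxi hxj => ?_)
    exact ((grid_lt_grid_iff (by omega) (by omega)).2 hlt).not_ge (hxj.1.trans hxi.2)
  · obtain ⟨k, rfl⟩ : Odd i := by grind
    obtain rfl : j = 2 * (k + 1) + 1 := by omega
    right
    simpa [show (2 * k + 1) / 2 = k by omega, show (2 * k + 1 + 1) / 2 = k + 1 by omega,
      show (2 * (k + 1) + 1) / 2 = k + 1 by omega,
      show (2 * (k + 1) + 1 + 1) / 2 = k + 1 + 1 by omega] using H.height_ne (k + 1) (by omega)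

theorem disjoint_side_base {i : ℕ} (hi : 0 < i) (hiK : i < 2 * H.numBars) :
    Disjoint (H.side i) H.base := by
  refine Set.disjoint_prod.2 (Or.inr ?_)
  obtain ⟨k, hk⟩ : ∃ k, (i + 1) / 2 = k + 1 := ⟨(i + 1) / 2 - 1, by omega⟩
  have hleft := H.height_pos k (by omega)
  have hright := H.height_pos (i / 2) (by omega)
  rw [hk, Set.disjoint_singleton_right]
  exact fun hzero => (lt_min hleft hright).not_ge hzero.1

theorem segment_vertex_next_of_le {i : Fin (2 * H.numBars + 2)} (hi : i.val ≤ 2 * H.numBars) :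
    segment ℝ (H.vertex i) (H.vertex (next i)) = H.side i := by
  rw [val_next_of_lt (by omega), segment_vertex hi]

theorem segment_vertex_next_of_eq {i : Fin (2 * H.numBars + 2)} (hi : i.val = 2 * H.numBars + 1) :
    segment ℝ (H.vertex i) (H.vertex (next i)) = H.base := by
  rw [val_next_of_eq (by omega), hi, segment_vertex_last]

theorem even_val_next {i : Fin (2 * H.numBars + 2)} : Even (next i).val ↔ Odd i.val := by
  rcases (Nat.lt_or_eq_of_le i.isLt) with hi | hi
  · rw [val_next_of_lt hi, Nat.even_add_one, Nat.not_even_iff_odd]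
  · rw [val_next_of_eq hi]
    grind

theorem isVertical_vertex_next {i : Fin (2 * H.numBars + 2)} (hi : Even i.val) :
    IsVertical (H.vertex i) (H.vertex (next i)) := by
  have hle : i.val ≤ 2 * H.numBars := by grind
  rw [val_next_of_lt (by omega)]
  exact isVertical_vertex hle hi

theorem isHorizontal_vertex_next {i : Fin (2 * H.numBars + 2)} (hi : Odd i.val) :
    IsHorizontal (H.vertex i) (H.vertex (next i)) := by
  rcases (Nat.lt_or_eq_of_le i.isLt) with hlt | hlast
  · rw [val_next_of_lt hlt]
    exact isHorizontal_vertex (by grind) hi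
  · rw [val_next_of_eq hlast, show i.val = 2 * H.numBars + 1 by omega]
    exact isHorizontal_vertex_last

theorem isHorizontal_isVertical_alternating (i : Fin (2 * H.numBars + 2)) :
    (IsHorizontal (H.vertex i) (H.vertex (next i)) ∧
      IsVertical (H.vertex (next i)) (H.vertex (next (next i)))) ∨
    (IsVertical (H.vertex i) (H.vertex (next i)) ∧
      IsHorizontal (H.vertex (next i)) (H.vertex (next (next i)))) := by
  rcases Nat.even_or_odd i.val with heven | hodd
  · have hnext : Odd (next i).val := by
      rwa [← Nat.not_even_iff_odd, even_val_next, Nat.not_odd_iff_even]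
    exact Or.inr ⟨isVertical_vertex_next heven, isHorizontal_vertex_next hnext⟩
  · exact Or.inl ⟨isHorizontal_vertex_next hodd, isVertical_vertex_next (even_val_next.2 hodd)⟩

theorem disjoint_segment_vertex {i j : Fin (2 * H.numBars + 2)} (hij : i ≠ j) (hji : j ≠ next i)
    (hij' : i ≠ next j) :
    Disjoint (segment ℝ (H.vertex i) (H.vertex (next i)))
      (segment ℝ (H.vertex j) (H.vertex (next j))) := by
  wlog hlt : i < j generalizing i j
  · exact (this hij.symm hij' hji (hij.lt_or_gt.resolve_left hlt)).symm
  have hile : i.val ≤ 2 * H.numBars := by omega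
  have hgap : i.val + 2 ≤ j.val := by
    rw [Ne, Fin.ext_iff, val_next_of_lt (by omega)] at hji
    omega
  rw [segment_vertex_next_of_le hile]
  rcases Nat.lt_or_ge (2 * H.numBars) j.val with hlast | hjle
  · have hj : j.val = 2 * H.numBars + 1 := by omega
    have hi : i.val ≠ 0 := fun hi => hij' (Fin.ext (hi.trans (val_next_of_eq (by omega)).symm))
    rw [segment_vertex_next_of_eq hj]
    exact disjoint_side_base (Nat.pos_of_ne_zero hi) (by omega)
  · rw [segment_vertex_next_of_le hjle]
    exact disjoint_side_side hgap hjle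

theorem iUnion_segment_vertex :
    ⋃ i : Fin (2 * H.numBars + 2), segment ℝ (H.vertex i) (H.vertex (next i)) =
      (⋃ i ∈ Set.Iic (2 * H.numBars), H.side i) ∪ H.base := by
  refine (Set.iUnion_subset fun i => ?_).antisymm
    (Set.union_subset (Set.iUnion₂_subset fun i (hi : i ≤ _) => ?_) ?_)
  · rcases Nat.lt_or_ge (2 * H.numBars) i.val with hlast | hi
    · rw [segment_vertex_next_of_eq (by omega)]
      exact Set.subset_union_right
    · rw [segment_vertex_next_of_le hi]
      exact Set.subset_union_of_subset_left
        (Set.subset_biUnion_of_mem (u := H.side) (Set.mem_Iic.2 hi)) _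
  · refine Set.subset_iUnion_of_subset ⟨i, by omega⟩ ?_
    rw [segment_vertex_next_of_le hi]
  · refine Set.subset_iUnion_of_subset ⟨2 * H.numBars + 1, by omega⟩ ?_
    rw [segment_vertex_next_of_eq rfl]

theorem height_nonneg {j : ℕ} (hj : j ≤ H.numBars + 1) : 0 ≤ H.height j := by
  rcases j with _ | j
  · exact H.height_zero.ge
  · rcases Nat.lt_or_eq_of_le (Nat.le_of_succ_le_succ hj) with hlt | rfl
    · exact (H.height_pos j hlt).le
    · exact H.height_last.ge

theorem side_two_mul_subset_region_diff_interior {j : ℕ} (hj : j ≤ H.numBars) :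
    H.side (2 * j) ⊆ H.region \ interior H.region := by
  rw [side_two_mul]
  rintro ⟨x, y⟩ ⟨rfl, hy⟩
  rcases le_total (H.height j) (H.height (j + 1)) with hle | hle
  · rw [Set.uIcc_of_le hle] at hy
    have hjK : j < H.numBars := hj.lt_of_ne fun hjK => by
      obtain ⟨i, rfl⟩ := Nat.exists_eq_succ_of_ne_zero (hjK ▸ H.numBars_pos.ne')
      exact (H.height_pos i hj).not_ge (hle.trans_eq (hjK ▸ H.height_last))
    refine ⟨mem_region.2 ⟨j, hjK, ⟨le_rfl, (grid_le_grid_iff hj hjK).2 j.le_succ⟩,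
      (height_nonneg (hj.trans (Nat.le_succ _))).trans hy.1, hy.2⟩, fun hinterior => ?_⟩
    obtain ⟨hx, -, hbelow⟩ := mem_interior_region.1 hinterior
    rcases j with _ | i
    · exact hx.1.false
    · exact (hbelow i hj ⟨(grid_le_grid_iff (by omega) hj).2 i.le_succ, le_rfl⟩).not_ge hy.1
  · rw [Set.uIcc_of_ge hle] at hy
    obtain ⟨i, rfl⟩ : ∃ i, j = i + 1 := Nat.exists_eq_succ_of_ne_zero fun hj0 => by
      subst hj0
      exact (H.height_pos 0 H.numBars_pos).not_ge (hle.trans_eq H.height_zero)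
    refine ⟨mem_region.2 ⟨i, hj, ⟨(grid_le_grid_iff (by omega) hj).2 i.le_succ, le_rfl⟩,
      (height_nonneg (by omega)).trans hy.1, hy.2⟩, fun hinterior => ?_⟩
    obtain ⟨hx, -, hbelow⟩ := mem_interior_region.1 hinterior
    rcases hj.lt_or_eq with hlt | hlast
    · exact (hbelow (i + 1) hlt ⟨le_rfl, (grid_le_grid_iff hj hlt).2 (i + 1).le_succ⟩).not_ge hy.1
    · exact hx.2.ne (congrArg H.grid hlast)

theorem side_two_mul_add_one_subset_region_diff_interior {j : ℕ} (hj : j < H.numBars) :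
    H.side (2 * j + 1) ⊆ H.region \ interior H.region := by
  rw [side_two_mul_add_one]
  rintro ⟨x, y⟩ ⟨hx, rfl⟩
  exact ⟨mem_region.2 ⟨j, hj, hx, (H.height_pos j hj).le, le_rfl⟩,
    fun hinterior => ((mem_interior_region.1 hinterior).2.2 j hj hx).false⟩

theorem base_subset_region_diff_interior : H.base ⊆ H.region \ interior H.region := by
  rintro ⟨x, y⟩ ⟨hx, rfl⟩
  obtain ⟨j, -, hj, hxj⟩ := exists_mem_Icc_succ H.numBars_pos hx
  exact ⟨mem_region.2 ⟨j, hj, hxj, le_rfl, (H.height_pos j hj).le⟩,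
    fun hinterior => (mem_interior_region.1 hinterior).2.1.false⟩

theorem region_diff_interior_subset :
    H.region \ interior H.region ⊆ (⋃ i ∈ Set.Iic (2 * H.numBars), H.side i) ∪ H.base := by
  rintro q ⟨hq, hinterior⟩
  have hwall {j : ℕ} (hj : j ≤ H.numBars) (hx : q.1 = H.grid j)
      (hy : q.2 ∈ Set.uIcc (H.height j) (H.height (j + 1))) :
      q ∈ (⋃ i ∈ Set.Iic (2 * H.numBars), H.side i) ∪ H.base :=
    Or.inl (Set.mem_biUnion (Set.mem_Iic.2 (by omega : 2 * j ≤ 2 * H.numBars))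
      (side_two_mul j ▸ ⟨hx, hy⟩))
  have hx : q.1 ∈ Set.Icc (H.grid 0) (H.grid H.numBars) := (region_subset hq).1
  obtain ⟨j, hj, hqj, hq0, hqheight⟩ := mem_region.1 hq
  rcases hq0.eq_or_lt with hzero | hpos
  · exact Or.inr ⟨hx, hzero.symm⟩
  rcases hx.1.eq_or_lt with hleft | hleft
  · obtain rfl : j = 0 := Nat.le_zero.1
      ((grid_le_grid_iff hj.le (Nat.zero_le _)).1 (hqj.1.trans_eq hleft.symm))
    exact hwall hj.le hleft.symm (Set.Icc_subset_uIcc ⟨H.height_zero.trans_le hq0, hqheight⟩)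
  rcases hx.2.eq_or_lt with hright | hright
  · obtain hlast : j + 1 = H.numBars := le_antisymm hj
      ((grid_le_grid_iff le_rfl hj).1 (hright.symm.trans_le hqj.2))
    exact hwall le_rfl hright (Set.Icc_subset_uIcc' ⟨H.height_last.trans_le hq0, hlast ▸ hqheight⟩)
  obtain ⟨i, hi, hqi, habove⟩ : ∃ i < H.numBars, q.1 ∈ Set.Icc (H.grid i) (H.grid (i + 1)) ∧
      H.height (i + 1) ≤ q.2 := by
    by_contra! hbelow
    exact hinterior (mem_interior_region.2 ⟨⟨hleft, hright⟩, hpos, hbelow⟩)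
  have hji : j ≤ i + 1 := (grid_le_grid_iff hj.le hi).1 (hqj.1.trans hqi.2)
  have hij : i ≤ j + 1 := (grid_le_grid_iff hi.le hj).1 (hqi.1.trans hqj.2)
  obtain rfl | rfl | rfl : i = j ∨ j = i + 1 ∨ i = j + 1 := by omega
  · exact Or.inl (Set.mem_biUnion (Set.mem_Iic.2 (by omega : 2 * i + 1 ≤ 2 * H.numBars))
      (side_two_mul_add_one i ▸ ⟨hqi, hqheight.antisymm habove⟩))
  · exact hwall hj.le (hqi.2.antisymm hqj.1) (Set.Icc_subset_uIcc ⟨habove, hqheight⟩)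
  · exact hwall hi.le (hqj.2.antisymm hqi.1) (Set.Icc_subset_uIcc' ⟨habove, hqheight⟩)

theorem frontier_region :
    frontier H.region =
      ⋃ i : Fin (2 * H.numBars + 2), segment ℝ (H.vertex i) (H.vertex (next i)) := by
  rw [isCompact_region.isClosed.frontier_eq, iUnion_segment_vertex]
  refine region_diff_interior_subset.antisymm (Set.union_subset (Set.iUnion₂_subset ?_)
    base_subset_region_diff_interior)
  intro i (hi : i ≤ 2 * H.numBars)
  rcases Nat.even_or_odd' i with ⟨j, rfl | rfl⟩
  · exact side_two_mul_subset_region_diff_interior (by omega)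
  · exact side_two_mul_add_one_subset_region_diff_interior (by omega)

variable (H)

/-- The histogram as a polygon. -/
def toPolygon : RectilinearPolygon where
  n := 2 * H.numBars + 2
  four_le := by have := H.numBars_pos; omega
  vertex i := H.vertex i
  alternating := isHorizontal_isVertical_alternating
  simple _ _ := disjoint_segment_vertex
  region := H.region
  isCompact_region := isCompact_region
  closure_interior_region := closure_interior_region
  frontier_region := frontier_region

variable {H}

theorem edgeLength_two_mul {i : Fin (2 * H.numBars + 2)} {j : ℕ} (hi : i.val = 2 * j) :
    H.toPolygon.edgeLength i = |H.height j - H.height (j + 1)| := by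
  change |(H.vertex i).1 - (H.vertex (next i)).1| + |(H.vertex i).2 - (H.vertex (next i)).2| = _
  rw [(isVertical_vertex_next (by grind)).1, sub_self, abs_zero, zero_add,
    val_next_of_lt (by omega), vertex, vertex, hi, show (2 * j + 1) / 2 = j by omega,
    show (2 * j + 1 + 1) / 2 = j + 1 by omega]

theorem edgeLength_two_mul_add_one {i : Fin (2 * H.numBars + 2)} {j : ℕ} (hi : i.val = 2 * j + 1)
    (hj : j < H.numBars) : H.toPolygon.edgeLength i = H.grid (j + 1) - H.grid j := by
  change |(H.vertex i).1 - (H.vertex (next i)).1| + |(H.vertex i).2 - (H.vertex (next i)).2| = _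
  rw [(isHorizontal_vertex_next (by grind)).1, sub_self, abs_zero, add_zero, abs_sub_comm,
    val_next_of_lt (by omega), vertex, vertex, hi, show (2 * j + 1 + 1) / 2 = j + 1 by omega,
    show (2 * j + 1) / 2 = j by omega,
    abs_of_pos (sub_pos.2 ((grid_lt_grid_iff hj.le hj).2 j.lt_succ_self))]

theorem edgeLength_last {i : Fin (2 * H.numBars + 2)} (hi : i.val = 2 * H.numBars + 1) :
    H.toPolygon.edgeLength i = H.grid H.numBars - H.grid 0 := by
  change |(H.vertex i).1 - (H.vertex (next i)).1| + |(H.vertex i).2 - (H.vertex (next i)).2| = _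
  have hwidth := (grid_lt_grid_iff (H := H) (Nat.zero_le _) le_rfl).2 H.numBars_pos
  rw [val_next_of_eq (by omega), hi, vertex_last, vertex_zero, sub_self, abs_zero, add_zero,
    abs_of_pos (sub_pos.2 hwidth)]

theorem aspectRatio_toPolygon {u : ℝ} (hwidth : ∀ j < H.numBars, u ≤ H.grid (j + 1) - H.grid j)
    (hjump : ∀ j ≤ H.numBars,
      |H.height j - H.height (j + 1)| ∈ Set.Icc u (H.grid H.numBars - H.grid 0))
    (hlast : H.height H.numBars = u) :
    H.toPolygon.aspectRatio = (H.grid H.numBars - H.grid 0) / u := by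
  have hmem (i : Fin (2 * H.numBars + 2)) :
      H.toPolygon.edgeLength i ∈ Set.Icc u (H.grid H.numBars - H.grid 0) := by
    have hi := i.isLt
    rcases Nat.even_or_odd' i.val with ⟨j, hij | hij⟩
    · exact edgeLength_two_mul hij ▸ hjump j (by omega)
    · rcases Nat.lt_or_ge j H.numBars with hj | hj
      · rw [edgeLength_two_mul_add_one hij hj]
        have hleft := (grid_le_grid_iff (H := H) (Nat.zero_le _) hj.le).2 j.zero_le
        have hright := (grid_le_grid_iff (H := H) hj le_rfl).2 hj
        exact ⟨hwidth j hj, sub_le_sub hright hleft⟩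
      · rw [edgeLength_last (by omega)]
        exact ⟨(hjump 0 (Nat.zero_le _)).1.trans (hjump 0 (Nat.zero_le _)).2, le_rfl⟩
  have hmin : H.toPolygon.edgeLength (⟨2 * H.numBars, by omega⟩ : Fin (2 * H.numBars + 2)) = u := by
    rw [edgeLength_two_mul rfl, H.height_last, sub_zero,
      abs_of_nonneg (height_nonneg (Nat.le_succ _)), hlast]
  have hmax : H.toPolygon.edgeLength (⟨2 * H.numBars + 1, by omega⟩ : Fin (2 * H.numBars + 2)) =
      H.grid H.numBars - H.grid 0 := edgeLength_last rfl
  refine RectilinearPolygon.aspectRatio_eq ⟨⟨_, hmin⟩, ?_⟩ ⟨⟨_, hmax⟩, ?_⟩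
  · rintro _ ⟨i, rfl⟩
    exact (hmem i).1
  · rintro _ ⟨i, rfl⟩
    exact (hmem i).2

end Histogram

/-! ### Pyramids -/

/-- The number, counted from the bottom, of the box that contains the `j`-th of `K` bars, when the
boxes of a pyramid are alternately inset at the right and at the left end: the bars on the left end
at the top of the boxes `1, 3, …`, those on the right at the top of the boxes `0, 2, …`. -/
def barLevel (K j : ℕ) : ℕ := if 2 * j + 1 < K then 2 * j + 1 else 2 * (K - 1 - j)

theorem barLevel_lt {K j : ℕ} (hj : j < K) : barLevel K j < K := by grind [barLevel]

theorem barLevel_ne_barLevel_succ {K j : ℕ} (hj : j + 1 < K) :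
    barLevel K j ≠ barLevel K (j + 1) := by grind [barLevel]

/-- A stack of `numBoxes` boxes on the `x`-axis with heights `height 0 < height 1 < ⋯` over a
decreasing sequence of intervals. From each box to the next only one end of the interval moves:
first the right end, from `right 0` to `right 1`, then the left end, from `left 0` to `left 1`, and
so on. -/
structure Pyramid where
  numBoxes : ℕ
  numBoxes_pos : 0 < numBoxes
  left : ℕ → ℝ
  right : ℕ → ℝ
  height : ℕ → ℝ
  strictMono_left : StrictMono left
  strictAnti_right : StrictAnti right
  left_lt_right_self : ∀ i, left i < right i
  strictMono_height : StrictMono height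
  height_pos : ∀ t, 0 < height t

namespace Pyramid

variable (P : Pyramid)

/-- The `t`-th box, counted from the bottom. -/
def box (t : ℕ) : Set Plane :=
  Set.Icc (P.left (t / 2)) (P.right ((t + 1) / 2)) ×ˢ Set.Icc 0 (P.height t)

/-- The vertical lines through the left and right ends of the boxes, from left to right. -/
noncomputable def grid (j : ℕ) : ℝ :=
  if 2 * j < P.numBoxes then P.left j else P.right (P.numBoxes - j)

/-- The heights of the bars into which the vertical lines cut the pyramid, with height `0` on either
side. -/
noncomputable def barHeight : ℕ → ℝ
  | 0 => 0
  | j + 1 => if j < P.numBoxes then P.height (barLevel P.numBoxes j) else 0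

variable {P}

theorem left_lt_right (i j : ℕ) : P.left i < P.right j :=
  calc P.left i ≤ P.left (max i j) := P.strictMono_left.monotone (le_max_left i j)
    _ < P.right (max i j) := P.left_lt_right_self _
    _ ≤ P.right j := P.strictAnti_right.antitone (le_max_right i j)

theorem grid_of_lt {j : ℕ} (hj : 2 * j < P.numBoxes) : P.grid j = P.left j := if_pos hj

theorem grid_of_le {j : ℕ} (hj : P.numBoxes ≤ 2 * j) : P.grid j = P.right (P.numBoxes - j) :=
  if_neg hj.not_gt

theorem grid_zero : P.grid 0 = P.left 0 := grid_of_lt P.numBoxes_pos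

theorem grid_last : P.grid P.numBoxes = P.right 0 := by
  rw [grid_of_le (by omega), Nat.sub_self]

theorem strictMonoOn_grid : StrictMonoOn P.grid (Set.Iic P.numBoxes) := by
  intro i _ j (hj : j ≤ P.numBoxes) hij
  rcases Nat.lt_or_ge (2 * i) P.numBoxes with hi | hi
  · rw [grid_of_lt hi]
    rcases Nat.lt_or_ge (2 * j) P.numBoxes with hj' | hj'
    · exact grid_of_lt hj' ▸ P.strictMono_left hij
    · exact grid_of_le hj' ▸ left_lt_right _ _
  · rw [grid_of_le hi, grid_of_le (by omega)]
    exact P.strictAnti_right (by omega)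

theorem barHeight_succ {j : ℕ} (hj : j < P.numBoxes) :
    P.barHeight (j + 1) = P.height (barLevel P.numBoxes j) := if_pos hj

theorem barHeight_last : P.barHeight (P.numBoxes + 1) = 0 := if_neg (lt_irrefl _)

theorem barHeight_ne_barHeight_succ {j : ℕ} (hj : j ≤ P.numBoxes) :
    P.barHeight j ≠ P.barHeight (j + 1) := by
  rcases j with _ | j
  · exact barHeight_succ P.numBoxes_pos ▸ (P.height_pos _).ne
  · rw [barHeight_succ hj]
    rcases hj.lt_or_eq with hlt | hlast
    · exact barHeight_succ hlt ▸ P.strictMono_height.injective.ne (barLevel_ne_barLevel_succ hlt)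
    · exact (hlast ▸ barHeight_last : P.barHeight (j + 1 + 1) = 0) ▸ (P.height_pos _).ne'

variable (P)

/-- The pyramid, cut into bars. -/
noncomputable def toHistogram : Histogram where
  numBars := P.numBoxes
  numBars_pos := P.numBoxes_pos
  grid := P.grid
  height := P.barHeight
  strictMonoOn_grid := strictMonoOn_grid
  height_zero := rfl
  height_last := barHeight_last
  height_pos _ hj := barHeight_succ hj ▸ P.height_pos _
  height_ne _ := barHeight_ne_barHeight_succ

/-- The pyramid as a polygon. -/
noncomputable abbrev toPolygon : RectilinearPolygon := P.toHistogram.toPolygon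

variable {P}

theorem bar_subset_box {j : ℕ} (hj : j < P.numBoxes) :
    P.toHistogram.bar j ⊆ P.box (barLevel P.numBoxes j) := by
  refine Set.prod_mono (Set.Icc_subset_Icc ?_ ?_)
    (Set.Icc_subset_Icc_right (barHeight_succ hj).le)
  · change _ ≤ P.grid j
    rcases Nat.lt_or_ge (2 * j) P.numBoxes with hlt | hle
    · rw [grid_of_lt hlt]
      exact P.strictMono_left.monotone (by grind [barLevel])
    · exact grid_of_le hle ▸ (left_lt_right _ _).le
  · change P.grid (j + 1) ≤ _
    rcases Nat.lt_or_ge (2 * (j + 1)) P.numBoxes with hlt | hle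
    · exact grid_of_lt hlt ▸ (left_lt_right _ _).le
    · rw [grid_of_le hle]
      exact P.strictAnti_right.antitone (by grind [barLevel])

theorem box_subset_region {t : ℕ} (ht : t < P.numBoxes) : P.box t ⊆ P.toPolygon.region := by
  rintro q ⟨hx, hy⟩
  have hleft : P.grid (t / 2) = P.left (t / 2) := grid_of_lt (by omega)
  have hright : P.grid (P.numBoxes - (t + 1) / 2) = P.right ((t + 1) / 2) := by
    rw [grid_of_le (by omega), Nat.sub_sub_self (by omega)]
  rw [← hleft, ← hright] at hx
  obtain ⟨j, hmj, hjk, hxj⟩ := exists_mem_Icc_succ (by omega) hx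
  have hj : j < P.numBoxes := by omega
  refine Histogram.mem_region.2 ⟨j, hj, hxj, hy.1, hy.2.trans ?_⟩
  change _ ≤ P.barHeight (j + 1)
  rw [barHeight_succ hj]
  exact P.strictMono_height.monotone (by grind [barLevel])

theorem mem_region {q : Plane} : q ∈ P.toPolygon.region ↔ ∃ t < P.numBoxes, q ∈ P.box t := by
  refine ⟨fun hq => ?_, fun ⟨t, ht, hq⟩ => box_subset_region ht hq⟩
  obtain ⟨j, hj, hqj⟩ := Histogram.mem_region.1 hq
  exact ⟨barLevel P.numBoxes j, barLevel_lt hj, bar_subset_box hj hqj⟩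

theorem orthoconvex_toPolygon : P.toPolygon.Orthoconvex := by
  refine ⟨fun y => ⟨?_⟩, fun x => ⟨?_⟩⟩
  · intro x₁ h₁ x₂ h₂ x hx
    obtain ⟨t₁, ht₁, hx₁, hy₁⟩ := mem_region.1 h₁
    obtain ⟨t₂, _, hx₂, hy₂⟩ := mem_region.1 h₂
    refine mem_region.2 ⟨min t₁ t₂, min_lt_of_left_lt ht₁, ⟨?_, ?_⟩, hy₁.1, ?_⟩
    · exact (P.strictMono_left.monotone (by omega)).trans (hx₁.1.trans hx.1)
    · exact hx.2.trans (hx₂.2.trans (P.strictAnti_right.antitone (by omega)))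
    · exact P.strictMono_height.monotone.map_min ▸ le_min hy₁.2 hy₂.2
  · intro y₁ h₁ y₂ h₂ y hy
    obtain ⟨t, ht, hx, hy₂⟩ := mem_region.1 h₂
    have hy₁ : 0 ≤ y₁ := (Histogram.region_subset h₁).2
    exact mem_region.2 ⟨t, ht, hx, hy₁.trans hy.1, hy.2.trans hy₂.2⟩

theorem le_grid_succ_sub_grid {u : ℝ} (hleft : ∀ i < P.numBoxes / 2, u ≤ P.left (i + 1) - P.left i)
    (hright : ∀ i < P.numBoxes / 2, u ≤ P.right i - P.right (i + 1))
    (htop : u ≤ P.right (P.numBoxes / 2) - P.left (P.numBoxes / 2)) {j : ℕ}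
    (hj : j < P.numBoxes) : u ≤ P.grid (j + 1) - P.grid j := by
  rcases Nat.lt_or_ge (2 * (j + 1)) P.numBoxes with hlt | hle
  · rw [grid_of_lt hlt, grid_of_lt (by omega)]
    exact hleft j (by omega)
  · rw [grid_of_le hle]
    rcases Nat.lt_or_ge (2 * j) P.numBoxes with hlt' | hle'
    · rw [grid_of_lt hlt']
      exact htop.trans (sub_le_sub (P.strictAnti_right.antitone (by omega))
        (P.strictMono_left.monotone (by omega)))
    · rw [grid_of_le hle', show P.numBoxes - j = P.numBoxes - (j + 1) + 1 by omega]
      exact hright _ (by omega)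

theorem barHeight_mem_Icc (j : ℕ) : P.barHeight j ∈ Set.Icc 0 (P.height (P.numBoxes - 1)) := by
  rcases j with _ | j
  · exact ⟨le_rfl, (P.height_pos _).le⟩
  · rw [barHeight]
    split_ifs with hj
    · exact ⟨(P.height_pos _).le,
        P.strictMono_height.monotone (Nat.le_sub_one_of_lt (barLevel_lt hj))⟩
    · exact ⟨le_rfl, (P.height_pos _).le⟩

theorem le_abs_height_sub_height {u : ℝ} (hstep : ∀ t, u ≤ P.height (t + 1) - P.height t)
    {s t : ℕ} (hst : s ≠ t) : u ≤ |P.height s - P.height t| := by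
  wlog hlt : s < t generalizing s t
  · exact abs_sub_comm (P.height t) _ ▸ this hst.symm (by omega)
  · rw [abs_sub_comm]
    calc u ≤ P.height (s + 1) - P.height s := hstep s
      _ ≤ P.height t - P.height s := sub_le_sub_right (P.strictMono_height.monotone hlt) _
      _ ≤ |P.height t - P.height s| := le_abs_self _

theorem le_abs_barHeight_sub_barHeight_succ {u : ℝ} (hbottom : u ≤ P.height 0)
    (hstep : ∀ t, u ≤ P.height (t + 1) - P.height t) {j : ℕ} (hj : j ≤ P.numBoxes) :
    u ≤ |P.barHeight j - P.barHeight (j + 1)| := by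
  have hheight (t : ℕ) : u ≤ |P.height t| :=
    hbottom.trans ((P.strictMono_height.monotone t.zero_le).trans (le_abs_self _))
  rcases j with _ | j
  · rw [barHeight_succ P.numBoxes_pos, barHeight, zero_sub, abs_neg]
    exact hheight _
  · rw [barHeight_succ hj]
    rcases hj.lt_or_eq with hlt | hlast
    · rw [barHeight_succ hlt]
      exact le_abs_height_sub_height hstep (barLevel_ne_barLevel_succ hlt)
    · rw [hlast, barHeight_last, sub_zero]
      exact hheight _

theorem aspectRatio_toPolygon
    (hstep : ∀ t, P.height 0 ≤ P.height (t + 1) - P.height t)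
    (hleft : ∀ i < P.numBoxes / 2, P.height 0 ≤ P.left (i + 1) - P.left i)
    (hright : ∀ i < P.numBoxes / 2, P.height 0 ≤ P.right i - P.right (i + 1))
    (htop : P.height 0 ≤ P.right (P.numBoxes / 2) - P.left (P.numBoxes / 2))
    (hwide : P.height (P.numBoxes - 1) ≤ P.right 0 - P.left 0) :
    P.toPolygon.aspectRatio = (P.right 0 - P.left 0) / P.height 0 := by
  rw [← grid_zero, ← grid_last] at hwide ⊢
  refine Histogram.aspectRatio_toPolygon (H := P.toHistogram)
    (fun j hj => le_grid_succ_sub_grid hleft hright htop hj)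
    (fun j hj => ⟨le_abs_barHeight_sub_barHeight_succ le_rfl hstep hj, ?_⟩) ?_
  · obtain ⟨h₁, h₁'⟩ := P.barHeight_mem_Icc j
    obtain ⟨h₂, h₂'⟩ := P.barHeight_mem_Icc (j + 1)
    exact (abs_sub_le_of_nonneg_of_le h₁ h₁' h₂ h₂').trans hwide
  · change P.barHeight P.numBoxes = P.height 0
    obtain ⟨k, hk⟩ := Nat.exists_eq_succ_of_ne_zero P.numBoxes_pos.ne'
    rw [hk, barHeight_succ (by omega)]
    exact congrArg P.height (by grind [barLevel])

theorem visible_eq_region :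
    P.toPolygon.visible (P.left (P.numBoxes / 2), 0) = P.toPolygon.region := by
  refine Set.Subset.antisymm (fun q hq => hq (right_mem_segment ℝ _ _)) fun q hq => ?_
  obtain ⟨t, ht, hqt⟩ := mem_region.1 hq
  have hconvex : Convex ℝ (P.box t) := (convex_Icc _ _).prod (convex_Icc _ _)
  have hcenter : (P.left (P.numBoxes / 2), 0) ∈ P.box t :=
    ⟨⟨P.strictMono_left.monotone (by omega), (left_lt_right _ _).le⟩, le_rfl, (P.height_pos t).le⟩
  exact (hconvex.segment_subset hcenter hqt).trans (box_subset_region ht)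

theorem region_inter_subset_region {P' : Pyramid} {m : ℕ} (hnum : P.numBoxes = P'.numBoxes)
    (hheight : P.height = P'.height) (hleft : ∀ i ≤ m, P.left i = P'.left i)
    (hright : ∀ i ≤ m, P.right i = P'.right i) :
    P.toPolygon.region ∩ {q | q.2 < P.height (2 * m)} ⊆ P'.toPolygon.region := by
  rintro q ⟨hq, hbelow⟩
  obtain ⟨t, ht, hx, hy⟩ := mem_region.1 hq
  refine mem_region.2 ⟨min t (2 * m), hnum ▸ min_lt_of_left_lt ht, ⟨?_, ?_⟩, hy.1, ?_⟩
  · rw [← hleft _ (by omega)]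
    exact (P.strictMono_left.monotone (by omega)).trans hx.1
  · rw [← hright _ (by omega)]
    exact hx.2.trans (P.strictAnti_right.antitone (by omega))
  · rw [← hheight, P.strictMono_height.monotone.map_min]
    exact le_min hy.2 (le_of_lt hbelow)

theorem fst_mem_Icc_of_height_lt_snd {m : ℕ} {q : Plane} (hq : q ∈ P.toPolygon.region)
    (hheight : P.height (2 * m + 1) < q.2) :
    q.1 ∈ Set.Icc (P.left (m + 1)) (P.right (m + 1)) := by
  obtain ⟨t, -, hx, hy⟩ := mem_region.1 hq
  have ht : 2 * m + 1 < t := P.strictMono_height.lt_iff_lt.1 (hheight.trans_le hy.2)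
  exact ⟨(P.strictMono_left.monotone (by omega)).trans hx.1,
    hx.2.trans (P.strictAnti_right.antitone (by omega))⟩

/-- If the top of the `2 * (m + 1)`-th box were visible, so would be the midpoint of the line of
sight, whose abscissa lies outside the interval under that box while its height exceeds the top of
the box before. -/
theorem snd_lt_of_mem_visible {m : ℕ} {p q : Plane}
    (hheight : 2 * P.height (2 * m + 1) < P.height (2 * (m + 1)))
    (hp : p.1 < 2 * P.left (m + 1) - P.right (m + 1) ∨
      2 * P.right (m + 1) - P.left (m + 1) < p.1)
    (hq : q ∈ P.toPolygon.visible p) : q.2 < P.height (2 * (m + 1)) := by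
  by_contra! hhigh
  have hp₂ : 0 ≤ p.2 := (Histogram.region_subset (hq (left_mem_segment ℝ p q))).2
  have hmid : midpoint ℝ p q = ((p.1 + q.1) / 2, (p.2 + q.2) / 2) := by
    ext <;> simp [midpoint_eq_smul_add] <;> ring
  have hpos := P.height_pos (2 * m + 1)
  have hq₁ := fst_mem_Icc_of_height_lt_snd (m := m) (hq (right_mem_segment ℝ p q)) (by linarith)
  have hmid₂ : P.height (2 * m + 1) < (midpoint ℝ p q).2 := by
    rw [hmid]
    linarith
  have hmid₁ := fst_mem_Icc_of_height_lt_snd (hq (midpoint_mem_segment p q)) hmid₂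
  rw [hmid] at hmid₁
  rcases hp with hp | hp
  · linarith [hmid₁.1, hq₁.2]
  · linarith [hmid₁.2, hq₁.1]

end Pyramid

/-! ### Pyramids with hidden tops -/

/-- The width of the `i`-th of a sequence of nested intervals. -/
noncomputable def width (w : ℝ) (i : ℕ) : ℝ := w / 9 ^ i

/-- The left end of the `i`-th of a sequence of nested intervals. The bit `b i` decides whether the
next interval lies near the right or near the left end of the `i`-th one. -/
noncomputable def leftEnd (w : ℝ) (b : ℕ → Bool) : ℕ → ℝ
  | 0 => 0
  | i + 1 => leftEnd w b i +
      if b i then width w i - 2 * width w (i + 1) else width w (i + 1)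

/-- The right end of the `i`-th of a sequence of nested intervals. -/
noncomputable def rightEnd (w : ℝ) (b : ℕ → Bool) (i : ℕ) : ℝ := leftEnd w b i + width w i

theorem width_eq_nine_mul (w : ℝ) (i : ℕ) : width w i = 9 * width w (i + 1) := by
  rw [width, width, pow_succ']
  field_simp

theorem leftEnd_congr {w : ℝ} {b b' : ℕ → Bool} {i : ℕ} (h : b' ∈ PiNat.cylinder b i) :
    leftEnd w b' i = leftEnd w b i := by
  induction i with
  | zero => rfl
  | succ i ih =>
    rw [leftEnd, leftEnd, ih (PiNat.cylinder_anti b i.le_succ h),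
      PiNat.mem_cylinder_iff.1 h i i.lt_succ_self]

theorem rightEnd_congr {w : ℝ} {b b' : ℕ → Bool} {i : ℕ} (h : b' ∈ PiNat.cylinder b i) :
    rightEnd w b' i = rightEnd w b i := by
  rw [rightEnd, rightEnd, leftEnd_congr h]

section

variable {w : ℝ} (hw : 0 < w) (b : ℕ → Bool)

include hw

theorem width_pos (i : ℕ) : 0 < width w i := by
  unfold width
  positivity

theorem width_antitone : Antitone (width w) :=
  antitone_nat_of_succ_le fun i => by linarith [width_eq_nine_mul w i, width_pos hw (i + 1)]

theorem leftEnd_lt_rightEnd (i : ℕ) : leftEnd w b i < rightEnd w b i :=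
  lt_add_of_pos_right _ (width_pos hw i)

theorem width_succ_le_leftEnd_succ_sub (i : ℕ) :
    width w (i + 1) ≤ leftEnd w b (i + 1) - leftEnd w b i := by
  rw [leftEnd, add_sub_cancel_left]
  split_ifs
  · linarith [width_eq_nine_mul w i, width_pos hw (i + 1)]
  · exact le_rfl

theorem width_succ_le_rightEnd_sub_succ (i : ℕ) :
    width w (i + 1) ≤ rightEnd w b i - rightEnd w b (i + 1) := by
  rw [rightEnd, rightEnd, leftEnd]
  split_ifs <;> linarith [width_eq_nine_mul w i, width_pos hw (i + 1)]

theorem strictMono_leftEnd : StrictMono (leftEnd w b) :=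
  strictMono_nat_of_lt_succ fun i =>
    sub_pos.1 ((width_pos hw (i + 1)).trans_le (width_succ_le_leftEnd_succ_sub hw b i))

theorem strictAnti_rightEnd : StrictAnti (rightEnd w b) :=
  strictAnti_nat_of_succ_lt fun i =>
    sub_pos.1 ((width_pos hw (i + 1)).trans_le (width_succ_le_rightEnd_sub_succ hw b i))

theorem exists_bit_far (m : ℕ) (x : ℝ) :
    ∃ β, ∀ b' ∈ PiNat.cylinder (Function.update b m β) (m + 1),
      x < leftEnd w b' (m + 1) - width w (m + 1) ∨
        rightEnd w b' (m + 1) + width w (m + 1) < x := by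
  have hwidth := width_eq_nine_mul w m
  have hpos := width_pos hw (m + 1)
  rcases le_or_gt x (leftEnd w b m + width w m / 2) with hx | hx
  · refine ⟨true, fun b' hb' => Or.inl ?_⟩
    rw [leftEnd_congr hb', leftEnd, leftEnd_congr (PiNat.update_mem_cylinder b m true),
      Function.update_self, if_pos rfl]
    linarith
  · refine ⟨false, fun b' hb' => Or.inr ?_⟩
    rw [rightEnd_congr hb', rightEnd, leftEnd,
      leftEnd_congr (PiNat.update_mem_cylinder b m false), Function.update_self,
      if_neg Bool.false_ne_true]
    linarith

end

section

variable {K : ℕ} (hK : 0 < K) {w : ℝ} (hw : 0 < w) {u : ℝ} (hu : 0 < u)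

/-- The pyramid of `K` boxes over the nested intervals encoded by the bits `b`, whose lowest box has
width `w` and height `u`. -/
noncomputable def bitPyramid (b : ℕ → Bool) : Pyramid where
  numBoxes := K
  numBoxes_pos := hK
  left := leftEnd w b
  right := rightEnd w b
  height t := u * 3 ^ t
  strictMono_left := strictMono_leftEnd hw b
  strictAnti_right := strictAnti_rightEnd hw b
  left_lt_right_self := leftEnd_lt_rightEnd hw b
  strictMono_height := (pow_right_strictMono₀ (by norm_num)).const_mul hu
  height_pos _ := by positivity

/-- The point on the top of the pyramid that the adversary keeps out of sight. -/
noncomputable def bitApex (K : ℕ) (w u : ℝ) (b : ℕ → Bool) : Plane :=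
  (leftEnd w b (K / 2), u * 3 ^ (K - 1))

theorem bitApex_mem_region (b : ℕ → Bool) :
    bitApex K w u b ∈ (bitPyramid hK hw hu b).toPolygon.region :=
  Pyramid.mem_region.2 ⟨K - 1, Nat.sub_one_lt hK.ne',
    ⟨(strictMono_leftEnd hw b).monotone (by omega),
      ((bitPyramid hK hw hu b).left_lt_right _ _).le⟩,
    ((bitPyramid hK hw hu b).height_pos _).le, le_rfl⟩

theorem zero_mem_region_bitPyramid (b : ℕ → Bool) :
    (0, 0) ∈ (bitPyramid hK hw hu b).toPolygon.region :=
  Pyramid.mem_region.2 ⟨0, hK, ⟨le_rfl, ((bitPyramid hK hw hu b).left_lt_right 0 _).le⟩,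
    le_rfl, ((bitPyramid hK hw hu b).height_pos _).le⟩

theorem aspectRatio_bitPyramid (huw : u * 9 ^ (K / 2) ≤ w) (b : ℕ → Bool) :
    (bitPyramid hK hw hu b).toPolygon.aspectRatio = w / u := by
  have hwidth : rightEnd w b 0 - leftEnd w b 0 = w := by simp [rightEnd, width]
  have hwidth_ge {i : ℕ} (hi : i ≤ K / 2) : u * 3 ^ 0 ≤ width w i :=
    calc u * 3 ^ 0 = u := by rw [pow_zero, mul_one]
      _ ≤ width w (K / 2) := (le_div_iff₀ (by positivity)).2 huw
      _ ≤ width w i := width_antitone hw hi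
  calc (bitPyramid hK hw hu b).toPolygon.aspectRatio
      = (rightEnd w b 0 - leftEnd w b 0) / (u * 3 ^ 0) :=
        Pyramid.aspectRatio_toPolygon (P := bitPyramid hK hw hu b) ?_ ?_ ?_ ?_ ?_
    _ = w / u := by rw [hwidth, pow_zero, mul_one]
  · intro t
    change u * 3 ^ 0 ≤ u * 3 ^ (t + 1) - u * 3 ^ t
    nlinarith [one_le_pow₀ (n := t) (show (1 : ℝ) ≤ 3 by norm_num), pow_succ (3 : ℝ) t]
  · exact fun i hi => (hwidth_ge hi).trans (width_succ_le_leftEnd_succ_sub hw b i)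
  · exact fun i hi => (hwidth_ge hi).trans (width_succ_le_rightEnd_sub_succ hw b i)
  · exact (hwidth_ge le_rfl).trans_eq (add_sub_cancel_left _ _).symm
  · calc u * 3 ^ (K - 1) ≤ u * 3 ^ (2 * (K / 2)) := by
          gcongr
          · norm_num
          · omega
      _ = u * 9 ^ (K / 2) := by rw [pow_mul]; norm_num
      _ ≤ w := huw
      _ = rightEnd w b 0 - leftEnd w b 0 := hwidth.symm

theorem region_bitPyramid_inter_eq {b b' : ℕ → Bool} {m : ℕ} (h : b' ∈ PiNat.cylinder b m) :
    (bitPyramid hK hw hu b').toPolygon.region ∩ {q | q.2 < u * 3 ^ (2 * m)} =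
      (bitPyramid hK hw hu b).toPolygon.region ∩ {q | q.2 < u * 3 ^ (2 * m)} := by
  have hsubset {b b' : ℕ → Bool} (h : b' ∈ PiNat.cylinder b m) :
      (bitPyramid hK hw hu b').toPolygon.region ∩ {q | q.2 < u * 3 ^ (2 * m)} ⊆
        (bitPyramid hK hw hu b).toPolygon.region :=
    Pyramid.region_inter_subset_region (P := bitPyramid hK hw hu b') rfl rfl
      (fun _ hi => leftEnd_congr (PiNat.cylinder_anti b hi h))
      (fun _ hi => rightEnd_congr (PiNat.cylinder_anti b hi h))
  exact Set.Subset.antisymm (Set.subset_inter (hsubset h) Set.inter_subset_right)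
    (Set.subset_inter (hsubset ((PiNat.mem_cylinder_comm _ _ _).1 h)) Set.inter_subset_right)

theorem visible_bitPyramid_subset {b : ℕ → Bool} {m : ℕ} {p : Plane}
    (hp : p.1 < leftEnd w b (m + 1) - width w (m + 1) ∨
      rightEnd w b (m + 1) + width w (m + 1) < p.1) :
    (bitPyramid hK hw hu b).toPolygon.visible p ⊆ {q | q.2 < u * 3 ^ (2 * (m + 1))} := by
  refine fun q hq => Pyramid.snd_lt_of_mem_visible (P := bitPyramid hK hw hu b) ?_ ?_ hq
  · change 2 * (u * 3 ^ (2 * m + 1)) < u * 3 ^ (2 * m + 1 + 1)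
    rw [pow_succ _ (2 * m + 1)]
    linarith [show 0 < u * 3 ^ (2 * m + 1) by positivity]
  · change p.1 < 2 * leftEnd w b (m + 1) - rightEnd w b (m + 1) ∨
      2 * rightEnd w b (m + 1) - leftEnd w b (m + 1) < p.1
    rw [rightEnd] at hp ⊢
    exact hp.imp (fun h => by linarith) (fun h => by linarith)

theorem evasive_bitPyramid :
    Evasive (fun b => (bitPyramid hK hw hu b).toPolygon) (bitApex K w u) ((K - 1) / 2) := by
  intro m hm b p
  obtain ⟨β, hβ⟩ := exists_bit_far hw b m p.1
  refine ⟨β, scan (bitPyramid hK hw hu (Function.update b m β)).toPolygon p, fun b' hb' => ?_⟩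
  have hlow := visible_bitPyramid_subset hK hw hu (hβ _ (PiNat.self_mem_cylinder _ _))
  refine ⟨scan_eq_of_region_inter_eq (isOpen_lt continuous_snd continuous_const)
    (region_bitPyramid_inter_eq hK hw hu hb')
    (visible_bitPyramid_subset hK hw hu (hβ b' hb')) hlow, fun happ => ?_⟩
  have hheight : u * 3 ^ (2 * (m + 1)) ≤ u * 3 ^ (K - 1) := by
    gcongr
    · norm_num
    · omega
  exact (hlow happ).not_ge hheight

theorem opt_bitPyramid_le (r : Rule) {c : ℝ≥0} (hwc : 2 * w ≤ c) (b : ℕ → Bool) :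
    opt r c (bitPyramid hK hw hu b).toPolygon (0, 0) ≤ (2 : ℝ≥0) * c := by
  have hnonneg : 0 ≤ leftEnd w b (K / 2) := (strictMono_leftEnd hw b).monotone (Nat.zero_le _)
  have hle : leftEnd w b (K / 2) ≤ w :=
    calc leftEnd w b (K / 2) ≤ rightEnd w b 0 :=
          ((bitPyramid hK hw hu b).left_lt_right _ _).le
      _ = w := by simp [rightEnd, leftEnd, width]
  have hdist : edist (WithLp.toLp 1 ((0, 0) : Plane))
      (WithLp.toLp 1 (leftEnd w b (K / 2), (0 : ℝ))) ≤ ENNReal.ofReal w := by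
    rw [WithLp.edist_toLp_fst, edist_dist, dist_zero_left, Real.norm_of_nonneg hnonneg]
    exact ENNReal.ofReal_le_ofReal hle
  calc opt r c (bitPyramid hK hw hu b).toPolygon (0, 0)
      ≤ c + 2 * edist (WithLp.toLp 1 ((0, 0) : Plane))
          (WithLp.toLp 1 (leftEnd w b (K / 2), (0 : ℝ))) :=
        opt_le_of_visible_eq_region (zero_mem_region_bitPyramid hK hw hu b)
          (bitPyramid hK hw hu b).visible_eq_region r c
    _ ≤ c + ENNReal.ofReal (2 * w) := by
        rw [ENNReal.ofReal_mul zero_le_two, ENNReal.ofReal_ofNat]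
        gcongr
    _ ≤ c + c := by
        gcongr
        exact ENNReal.ofReal_le_of_le_toReal hwc
    _ = (2 : ℝ≥0) * c := by rw [ENNReal.coe_ofNat, two_mul]

theorem numBoxes_le_of_isCompetitive {r : Rule} {c : ℝ≥0} (hwc : 2 * w ≤ c) {σ : Strategy}
    {ρ : ℝ≥0} {Cl : Set RectilinearPolygon} (hσ : σ.IsCompetitive r c Cl ρ)
    (hCl : ∀ b, (bitPyramid hK hw hu b).toPolygon ∈ Cl) : (K : ℝ) ≤ 4 * ρ := by
  have hc : 0 < c := NNReal.coe_pos.1 (by linarith)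
  have hscans := (evasive_bitPyramid hK hw hu).succ_le_mul_of_isCompetitive
    (bitApex_mem_region hK hw hu) hc (zero_mem_region_bitPyramid hK hw hu)
    (opt_bitPyramid_le hK hw hu r hwc) hCl hσ
  have hK' : (K : ℝ) ≤ 2 * (((K - 1) / 2 : ℕ) + 1) := by
    exact_mod_cast (by omega : K ≤ 2 * ((K - 1) / 2 + 1))
  linarith

end

/-! ### Lower bounds for the competitive ratio -/

variable {r : Rule} {c : ℝ≥0} {σ : Strategy} {ρ : ℝ≥0}

theorem log_le_mul_of_isCompetitive_aspectRatio (hc : 0 < c) {A : ℝ} (hA : 1 ≤ A)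
    (hσ : σ.IsCompetitive r c {P | P.Orthoconvex ∧ P.aspectRatio = A} ρ) :
    Real.log A ≤ 32 * ρ := by
  obtain ⟨p, hpA, hAp⟩ := exists_nat_pow_near hA (show (1 : ℝ) < 9 by norm_num)
  have hA0 : 0 < A := zero_lt_one.trans_le hA
  have hw : (0 : ℝ) < c / 2 := half_pos hc
  have hu : (0 : ℝ) < c / 2 / A := div_pos hw hA0
  have hK : 0 < 2 * p + 1 := Nat.succ_pos _
  have hbound : c / 2 / A * 9 ^ ((2 * p + 1) / 2) ≤ (c / 2 : ℝ) := by
    rw [show (2 * p + 1) / 2 = p by omega, div_mul_eq_mul_div, div_le_iff₀ hA0]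
    gcongr
  have haspect (b) : (bitPyramid hK hw hu b).toPolygon.aspectRatio = A := by
    rw [aspectRatio_bitPyramid hK hw hu hbound, div_div_cancel₀ hw.ne']
  have hρ : ((2 * p + 1 : ℕ) : ℝ) ≤ 4 * ρ := numBoxes_le_of_isCompetitive hK hw hu
    (by linarith) hσ fun b => ⟨Pyramid.orthoconvex_toPolygon, haspect b⟩
  have hlog9 : Real.log 9 ≤ 8 :=
    (Real.log_le_sub_one_of_pos (by norm_num)).trans_eq (by norm_num)
  calc Real.log A ≤ Real.log (9 ^ (p + 1)) := Real.log_le_log hA0 hAp.le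
    _ = (p + 1 : ℕ) * Real.log 9 := Real.log_pow _ _
    _ ≤ (2 * p + 1 : ℕ) * 8 := by gcongr; omega
    _ ≤ 32 * ρ := by linarith

theorem natCast_le_mul_of_isCompetitive_n (hc : 0 < c) {n : ℕ} (hn : 4 ≤ n) (heven : Even n)
    (hσ : σ.IsCompetitive r c {P | P.Orthoconvex ∧ P.n = n} ρ) : (n : ℝ) ≤ 16 * ρ := by
  obtain ⟨m, rfl⟩ := heven
  have hK : 0 < m - 1 := by omega
  have hw : (0 : ℝ) < c / 2 := half_pos hc
  have hnumEdges : 2 * (m - 1) + 2 = m + m := by omega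
  have hρ : ((m - 1 : ℕ) : ℝ) ≤ 4 * ρ := numBoxes_le_of_isCompetitive hK hw one_pos
    (by linarith) hσ fun _ => ⟨Pyramid.orthoconvex_toPolygon, hnumEdges⟩
  calc ((m + m : ℕ) : ℝ) ≤ 4 * (m - 1 : ℕ) := by exact_mod_cast (by omega : m + m ≤ 4 * (m - 1))
    _ ≤ 16 * ρ := by linarith

end Watchman

theorem mainTheorem1 :
    ∃ κ : ℝ, 0 < κ ∧
      ∀ (r : Watchman.Rule) (c : ℝ≥0), 0 < c →
        ∀ (σ : Watchman.Strategy) (ρ : ℝ≥0),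
          (∀ A : ℝ, 1 ≤ A →
            σ.IsCompetitive r c {P | P.Orthoconvex ∧ P.aspectRatio = A} ρ →
              κ * Real.log A ≤ ρ) ∧
          (∀ n : ℕ, 4 ≤ n → Even n →
            σ.IsCompetitive r c {P | P.Orthoconvex ∧ P.n = n} ρ →
              κ * n ≤ ρ) := by
  refine ⟨1 / 32, by norm_num, fun r c hc σ ρ => ⟨fun A hA hσ => ?_, fun n hn heven hσ => ?_⟩⟩
  · linarith [Watchman.log_le_mul_of_isCompetitive_aspectRatio hc hA hσ]
  · linarith [Watchman.natCast_le_mul_of_isCompetitive_n hc hn heven hσ, ρ.coe_nonneg]
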